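/- Let $k$ be a field and $f_1,f_2\in k[x_1,x_2]$. Write $k[f_1,f_2]$ for the $k$-subalgebra of $k[x_1,x_2]$ generated by $f_1,f_2$, write $k(f_1,f_2)\subseteq k(x_1,x_2)$ for its quotient field, and let $J(f_1,f_2)=\det\bigl[\partial f_i/\partial x_j\bigr]_{1\le i,j\le 2}$. For a prime $p$, the *two-dimensional Separable Jacobian Conjecture in characteristic $p$* is the statement: for every field $k$ of characteristic $p$ and all $f_1,f_2\in k[x_1,x_2]$, one has $k[x_1,x_2]=k[f_1,f_2]$ if and only if $J(f_1,f_2)\in k^*$ and the degree $[k(x_1,x_2):k(f_1,f_2)]$ is finite and not divisible by $p$. The *two-dimensional Jacobian Conjecture in characteristic $0$* is the statement: for every field $k$ of characteristic $0$ and all $f_1,f_2\in k[x_1,x_2]$, if $J(f_1,f_2)\in k^*$, then $k[x_1,x_2]=k[f_1,f_2]$. **Proposition 1.6.** If the two-dimensional Separable Jacobian Conjecture holds in characteristic $p$ for every prime $p$, then the two-dimensional Jacobian Conjecture in characteristic $0$ holds. -/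

import Mathlib

universe u

/-- The determinant of the Jacobian matrix `[∂ f_i / ∂ x_j]`. -/
noncomputable def jacobianDet {k : Type*} [Field k] {n : ℕ}
    (f : Fin n → MvPolynomial (Fin n) k) : MvPolynomial (Fin n) k :=
  Matrix.det (Matrix.of fun i j => MvPolynomial.pderiv j (f i))

/-- `f` is a Jacobian `n`-tuple: its Jacobian determinant is a nonzero constant. -/
def IsJacobianTuple {k : Type*} [Field k] {n : ℕ}
    (f : Fin n → MvPolynomial (Fin n) k) : Prop :=
  ∃ c : k, c ≠ 0 ∧ jacobianDet f = MvPolynomial.C c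

/-- `f` is an automorphic `n`-tuple: `k[f_1, …, f_n] = k[x_1, …, x_n]`. -/
def IsAutomorphicTuple {k : Type*} [Field k] {n : ℕ}
    (f : Fin n → MvPolynomial (Fin n) k) : Prop :=
  Algebra.adjoin k (Set.range f) = ⊤

/-- The subfield `k(f_1, …, f_n)` of the rational function field `k(x_1, …, x_n)`. -/
noncomputable def generatedField {k : Type*} [Field k] {n : ℕ}
    (f : Fin n → MvPolynomial (Fin n) k) :
    IntermediateField k (FractionRing (MvPolynomial (Fin n) k)) :=
  IntermediateField.adjoin k
    (Set.range fun i => algebraMap (MvPolynomial (Fin n) k)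
      (FractionRing (MvPolynomial (Fin n) k)) (f i))

/-- The degree `[k(x_1, …, x_n) : k(f_1, …, f_n)]`. If the extension is infinite, the value is `0`,
which every `p` divides; so "`p` does not divide the degree" includes that the degree is finite. -/
noncomputable def extensionDegree {k : Type*} [Field k] {n : ℕ}
    (f : Fin n → MvPolynomial (Fin n) k) : ℕ :=
  Module.finrank (generatedField f) (FractionRing (MvPolynomial (Fin n) k))

/-- The two-dimensional Separable Jacobian Conjecture in characteristic `p`
(for all fields of characteristic `p`). -/
def SeparableJacobianConjectureTwo (p : ℕ) : Prop :=
  ∀ (k : Type u) [Field k] [CharP k p] (f : Fin 2 → MvPolynomial (Fin 2) k),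
    IsAutomorphicTuple f ↔ IsJacobianTuple f ∧ ¬ p ∣ extensionDegree f

/-- The two-dimensional Jacobian Conjecture in characteristic `0`
(for all fields of characteristic `0`). -/
def JacobianConjectureTwo : Prop :=
  ∀ (k : Type u) [Field k] [CharZero k] (f : Fin 2 → MvPolynomial (Fin 2) k),
    IsJacobianTuple f → IsAutomorphicTuple f

open MvPolynomial

/-! If `X i` lies outside `k[f]`, some `k`-linear functional `l` vanishes on `k[f]` but not at `X
i`. Only finitely many scalars matter: the coefficients of `f`, its Jacobian, and the values of `l`
on finitely many monomials. They generate a ring that maps to an algebraic closure of `F_p` for some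
`p` above a prescribed bound, keeping the nonzero ones nonzero.

Two bounds, depending only on the degree `d` of `f` in each variable, make this work. The reduction
`g` has extension degree between `1` and `N = (2d+1)^2 < p`, so the separable conjecture makes `g`
automorphic. The inverse of `g` also has degree at most `N` in each variable, so `X i` is a
combination of products of powers of `g` with exponents at most `N`. The reduced functional kills
those products but not `X i`, a contradiction. -/

/-! ### Specialization to positive characteristic -/

instance Int.isJacobsonRing : IsJacobsonRing ℤ := by
  rw [isJacobsonRing_iff_prime_eq]
  intro P hP
  by_cases h : P = ⊥
  · subst h
    refine (Submodule.eq_bot_iff _).2 fun x hx => ?_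
    -- Here `x * x + 1` is a unit of `ℤ`, which forces `x = 0`.
    have := Int.isUnit_iff.1 (Ideal.mem_jacobson_bot.1 hx x)
    rcases this with h | h <;> nlinarith [mul_self_nonneg x]
  · have := hP.isMaximal h
    exact Ideal.jacobson_eq_self_of_isMaximal

/-- By the Nullstellensatz over `ℤ`, `S` is integral over `ℤ`; in characteristic `0` this would make
`ℤ` a field. -/
theorem exists_ringHom_algebraicClosure_zmod (S : Type*) [Field S]
    (hS : (Int.castRingHom S).FiniteType) :
    ∃ (p : ℕ) (_ : Fact p.Prime), CharP S p ∧ Nonempty (S →+* AlgebraicClosure (ZMod p)) := by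
  have : Algebra.FiniteType ℤ S := RingHom.finiteType_algebraMap.1 hS
  have hfin : Module.Finite ℤ S := finite_of_finite_type_of_isJacobsonRing ℤ S
  have hint : Algebra.IsIntegral ℤ S := inferInstance
  obtain ⟨p, hp⟩ := CharP.exists S
  rcases CharP.char_is_prime_or_zero S p with hpr | rfl
  · have : Fact p.Prime := ⟨hpr⟩
    let _ : Algebra (ZMod p) S := ZMod.algebra S p
    have : Algebra.IsIntegral (ZMod p) S := Algebra.IsIntegral.tower_top (R := ℤ)
    have : Algebra.IsAlgebraic (ZMod p) S := inferInstance
    exact ⟨p, ⟨hpr⟩, hp, ⟨(IsAlgClosed.lift : S →ₐ[ZMod p] AlgebraicClosure (ZMod p)).toRingHom⟩⟩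
  · have : CharZero S := CharP.charP_to_charZero S
    have hinj : Function.Injective (algebraMap ℤ S) := (algebraMap ℤ S).injective_int
    exact absurd (isField_of_isIntegral_of_isField hinj (Field.toIsField S)) Int.not_isField

theorem exists_subring_ringHom_algebraicClosure_zmod {k : Type*} [Field k] [CharZero k]
    (s : Finset k) (N : ℕ) :
    ∃ (R : Subring k) (p : ℕ) (_ : Fact p.Prime) (φ : R →+* AlgebraicClosure (ZMod p)),
      N < p ∧ (↑s : Set k) ⊆ R ∧ ∀ x : R, (x : k) ∈ s → (x : k) ≠ 0 → φ x ≠ 0 := by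
  classical
  -- Nonzero elements of `s'` become units, so they survive in every residue field. Inverting `N!`
  -- excludes `p ≤ N`.
  set s' : Finset k := s ∪ {(N.factorial : k)}
  set t : Finset k := s' ∪ s'.image (·⁻¹)
  set A := Algebra.adjoin ℤ (t : Set k)
  have hA : Algebra.FiniteType ℤ A := (Subalgebra.fg_iff_finiteType _).1 (Subalgebra.fg_adjoin_finset t)
  have hs : ∀ x ∈ s', x ∈ A := fun x hx => Algebra.subset_adjoin (by simp [t]; exact Or.inl hx)
  have hs_inv : ∀ x ∈ s', x⁻¹ ∈ A := fun x hx =>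
    Algebra.subset_adjoin (by simp [t]; exact Or.inr hx)
  have hunit : ∀ x : A, (x : k) ∈ s' → (x : k) ≠ 0 → IsUnit x := fun x hx h0 =>
    IsUnit.of_mul_eq_one (⟨_, hs_inv _ hx⟩ : A) (Subtype.ext (mul_inv_cancel₀ h0))
  obtain ⟨m, hm⟩ := Ideal.exists_maximal A
  let _ : Field (A ⧸ m) := Ideal.Quotient.field m
  have hquot : (Int.castRingHom (A ⧸ m)).FiniteType := by
    rw [show Int.castRingHom (A ⧸ m) = (Ideal.Quotient.mk m).comp (algebraMap ℤ A) from
      Subsingleton.elim _ _]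
    exact (RingHom.finiteType_algebraMap.2 hA).comp_surjective Ideal.Quotient.mk_surjective
  obtain ⟨p, hp, hchar, ⟨ψ⟩⟩ := exists_ringHom_algebraicClosure_zmod (A ⧸ m) hquot
  set φ : A.toSubring →+* AlgebraicClosure (ZMod p) := ψ.comp (Ideal.Quotient.mk m)
  have hne : ∀ x : A, (x : k) ∈ s' → (x : k) ≠ 0 → φ x ≠ 0 := fun x hx h0 =>
    ((hunit x hx h0).map φ).ne_zero
  refine ⟨A.toSubring, p, hp, φ, ?_, fun x hx => hs x (Finset.mem_union_left _ hx),
    fun x hx => hne x (Finset.mem_union_left _ hx)⟩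
  by_contra! hle
  refine hne (N.factorial : A) (by simp [s']) (by simpa using N.factorial_ne_zero) ?_
  rw [show φ (N.factorial : A) = (N.factorial : AlgebraicClosure (ZMod p)) from map_natCast φ _,
    CharP.cast_eq_zero_iff _ p]
  exact (hp.out.dvd_factorial).2 hle

/-! ### Jacobian criterion in characteristic `p` -/

theorem pderiv_aeval_eq_sum {R σ τ : Type*} [CommSemiring R] [Fintype σ]
    (f : σ → MvPolynomial τ R) (j : τ) (P : MvPolynomial σ R) :
    pderiv j (aeval f P) = ∑ i, aeval f (pderiv i P) * pderiv j (f i) := by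
  classical
  induction P using MvPolynomial.induction_on with
  | C a => simp [← algebraMap_eq]
  | add p q hp hq => simp only [map_add, hp, hq, add_mul, Finset.sum_add_distrib]
  | mul_X p i hp =>
    simp only [map_mul, aeval_X, pderiv_mul, hp, pderiv_X, map_add, add_mul,
      Finset.sum_add_distrib, Finset.sum_mul]
    congr 1
    · exact Finset.sum_congr rfl fun _ _ => by ring
    · simp [Pi.single_apply, Finset.sum_ite_eq]

theorem totalDegree_pderiv_lt {R σ : Type*} [CommSemiring R] {P : MvPolynomial σ R}
    (h : P.totalDegree ≠ 0) (i : σ) : (pderiv i P).totalDegree < P.totalDegree := by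
  classical
  rw [totalDegree, Finset.sup_lt_iff (Nat.pos_of_ne_zero h)]
  intro m hm
  have hm' : m + Finsupp.single i 1 ∈ P.support := by
    rw [mem_support_iff, coeff_pderiv] at hm
    exact mem_support_iff.2 fun h0 => hm (by simp [h0])
  have := le_totalDegree hm'
  rw [Finsupp.sum_add_index' (by simp) (by simp)] at this
  simp at this
  omega

/-- Only exponents divisible by `p` occur, and perfectness supplies `p`-th roots of the
coefficients. -/
theorem exists_pow_eq_of_pderiv_eq_zero {K σ : Type*} [Field K] (p : ℕ) [Fact p.Prime] [CharP K p]
    [PerfectRing K p] {P : MvPolynomial σ K} (h : ∀ i, pderiv i P = 0) :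
    ∃ Q : MvPolynomial σ K, P = Q ^ p := by
  classical
  have hp : p.Prime := Fact.out
  refine ⟨∑ m ∈ P.support, monomial (m.mapRange (· / p) (Nat.zero_div p))
    ((frobeniusEquiv K p).symm (coeff m P)), ?_⟩
  rw [sum_pow_char]
  conv_lhs => rw [P.as_sum]
  refine Finset.sum_congr rfl fun m hm => ?_
  rw [monomial_pow]
  refine congrArg₂ (fun a b => monomial a b) ?_ ?_
  · ext i
    have hdvd : p ∣ m i := by
      rcases Nat.eq_zero_or_pos (m i) with h0 | h0
      · simp [h0]
      have hsub : m - Finsupp.single i 1 + Finsupp.single i 1 = m :=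
        tsub_add_cancel_of_le (Finsupp.single_le_iff.2 h0)
      have hc := coeff_pderiv (i := i) P (m - Finsupp.single i 1)
      rw [h i, hsub, coeff_zero, eq_comm, mul_eq_zero] at hc
      rcases hc with hc | hc
      · exact absurd hc (mem_support_iff.1 hm)
      · rw [← CharP.cast_eq_zero_iff K p, ← hc]
        have : (m - Finsupp.single i 1 : σ →₀ ℕ) i + 1 = m i := by simp; omega
        rw [← this]
        push_cast
        rfl
    simp [Nat.mul_div_cancel' hdvd]
  · exact (frobenius_apply_frobeniusEquiv_symm K p _).symm

theorem totalDegree_pow_of_isDomain {R σ : Type*} [CommRing R] [IsDomain R]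
    {Q : MvPolynomial σ R} (hQ : Q ≠ 0) (n : ℕ) : (Q ^ n).totalDegree = n * Q.totalDegree := by
  induction n with
  | zero => simp
  | succ n ih => rw [pow_succ, totalDegree_mul_of_isDomain (pow_ne_zero n hQ) hQ, ih]; ring

/-- By the chain rule, the partial derivatives of a relation are again relations, of lower degree,
hence zero by induction. The relation is then a `p`-th power, whose root is a smaller relation. -/
theorem algebraicIndependent_of_jacobianDet_ne_zero {K : Type*} [Field K] (p : ℕ) [Fact p.Prime]
    [CharP K p] [PerfectRing K p] {n : ℕ} {f : Fin n → MvPolynomial (Fin n) K}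
    (hf : jacobianDet f ≠ 0) : AlgebraicIndependent K f := by
  have hp : p.Prime := Fact.out
  rw [algebraicIndependent_iff]
  intro P
  induction hd : P.totalDegree using Nat.strong_induction_on generalizing P with
  | _ d ih =>
  subst hd
  intro hP
  by_cases h0 : P.totalDegree = 0
  · rw [totalDegree_eq_zero_iff_eq_C] at h0
    rw [h0, aeval_C, algebraMap_eq, C_eq_zero] at hP
    rw [h0, hP, C_0]
  have hvec : (fun i => aeval f (pderiv i P)) = 0 := by
    refine Matrix.eq_zero_of_vecMul_eq_zero hf ?_
    ext1 j
    have := pderiv_aeval_eq_sum f j P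
    rw [hP, map_zero] at this
    exact this.symm
  have hder : ∀ i, pderiv i P = 0 := fun i =>
    ih _ (totalDegree_pderiv_lt h0 i) _ rfl (congrFun hvec i)
  obtain ⟨Q, rfl⟩ := exists_pow_eq_of_pderiv_eq_zero p hder
  have hQ : Q ≠ 0 := by rintro rfl; simp [hp.ne_zero] at h0
  rw [map_pow] at hP
  have hdeg : (Q ^ p).totalDegree = p * Q.totalDegree := totalDegree_pow_of_isDomain hQ p
  refine absurd (ih _ ?_ Q rfl (eq_zero_of_pow_eq_zero hP)) hQ
  rw [hdeg] at h0 ⊢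
  have := hp.two_le
  nlinarith [Nat.pos_of_ne_zero (right_ne_zero_of_mul h0)]

/-! ### Bounding the extension degree by dimension counts -/

theorem card_le_of_linearIndependent_of_degreeOf_le {K σ ι : Type*} [Field K] [Fintype σ]
    [Fintype ι] {v : ι → MvPolynomial σ K} (hv : LinearIndependent K v) {M : ℕ}
    (hM : ∀ i j, degreeOf j (v i) ≤ M) : Fintype.card ι ≤ (M + 1) ^ Fintype.card σ := by
  classical
  let Φ : MvPolynomial σ K →ₗ[K] ((σ → Fin (M + 1)) → K) :=
    LinearMap.pi fun e => lcoeff K (Finsupp.equivFunOnFinite.symm fun j => (e j : ℕ))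
  have hspan : Submodule.span K (Set.range v) ≤ restrictDegree σ K M := by
    rw [Submodule.span_le]
    rintro _ ⟨i, rfl⟩
    exact (mem_restrictDegree _ _ _).2 fun m hm j => degreeOf_le_iff.1 (hM i j) m hm
  have hdisj : Disjoint (Submodule.span K (Set.range v)) (LinearMap.ker Φ) := by
    rw [Submodule.disjoint_def]
    intro P hP hker
    have hP' := (mem_restrictDegree _ _ _).1 (hspan hP)
    ext m
    by_contra hm
    have hle := hP' m (mem_support_iff.2 hm)
    have := congrFun (LinearMap.mem_ker.1 hker) fun j => ⟨m j, Nat.lt_succ_of_le (hle j)⟩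
    refine hm ?_
    simpa [Φ, lcoeff] using this
  have := (hv.map hdisj).fintype_card_le_finrank
  simpa using this

section BoundedPowers

variable {K : Type*} [Field K] {n : ℕ} (f : Fin n → MvPolynomial (Fin n) K) {N : ℕ}

theorem aeval_monomial_equivFunOnFinite_symm (e : Fin n → ℕ) :
    aeval f (monomial (Finsupp.equivFunOnFinite.symm e) (1 : K)) = ∏ i, f i ^ e i := by
  rw [aeval_monomial, Finsupp.prod_fintype _ _ (by simp)]
  simp

theorem linearIndependent_monomial_fin_box :
    LinearIndependent K fun e : Fin n → Fin (N + 1) =>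
      monomial (R := K) (Finsupp.equivFunOnFinite.symm fun i => (e i : ℕ)) 1 := by
  have h := (basisMonomials (Fin n) K).linearIndependent
  rw [coe_basisMonomials] at h
  refine h.comp (fun e : Fin n → Fin (N + 1) =>
    Finsupp.equivFunOnFinite.symm fun i => (e i : ℕ)) fun e e' hee => ?_
  ext i
  exact congrFun (Finsupp.equivFunOnFinite.symm.injective hee) i

variable {f}

theorem AlgebraicIndependent.linearIndependent_prod_pow (hf : AlgebraicIndependent K f) :
    LinearIndependent K fun e : Fin n → Fin (N + 1) => ∏ i, f i ^ (e i : ℕ) := by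
  have := linearIndependent_monomial_fin_box (K := K) (n := n) (N := N)
  have h2 := this.map' (aeval f).toLinearMap (LinearMap.ker_eq_bot.2 hf)
  have heq : (fun e : Fin n → Fin (N + 1) => ∏ i, f i ^ (e i : ℕ)) = (aeval f).toLinearMap ∘ _ :=
    funext fun e => (aeval_monomial_equivFunOnFinite_symm f fun i => (e i : ℕ)).symm
  rw [heq]
  exact h2

theorem degreeOf_prod_pow_le {d : ℕ} (hd : ∀ i j, degreeOf j (f i) ≤ d)
    (e : Fin n → Fin (N + 1)) (j : Fin n) : degreeOf j (∏ i, f i ^ (e i : ℕ)) ≤ n * d * N := by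
  refine (degreeOf_prod_le _ _ _).trans ?_
  calc ∑ i, degreeOf j (f i ^ (e i : ℕ)) ≤ ∑ _i : Fin n, N * d := by
        refine Finset.sum_le_sum fun i _ => (degreeOf_pow_le _ _ _).trans ?_
        exact Nat.mul_le_mul (Nat.lt_succ_iff.1 (e i).2) (hd i j)
    _ = n * d * N := by simp; ring

end BoundedPowers

section ClearDenominators

variable {A F : Type*} [CommRing A] [Field F] [Algebra A F] [IsFractionRing A F]

theorem exists_linearIndependent_algebraMap [Nontrivial A] {L : Type*} [Field L] [Algebra L F]
    (s : Finset F)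
    (hs : LinearIndependent L fun x : s => (x : F)) :
    ∃ a : s → A, LinearIndependent L fun x => algebraMap A F (a x) := by
  obtain ⟨r, hr⟩ := IsLocalization.exist_integer_multiples_of_finset (nonZeroDivisors A) s
  choose a ha using fun x : s => hr x x.2
  have hr0 : algebraMap A F r ≠ 0 :=
    IsFractionRing.to_map_ne_zero_of_mem_nonZeroDivisors r.2
  refine ⟨a, ?_⟩
  have := hs.map' (LinearMap.mulLeft L (algebraMap A F r))
    (LinearMap.ker_eq_bot.2 fun x y hxy => mul_left_cancel₀ hr0 hxy)
  have heq : (fun x : s => algebraMap A F (a x)) =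
      LinearMap.mulLeft L (algebraMap A F r) ∘ fun x : s => (x : F) :=
    funext fun x => (ha x).trans (Algebra.smul_def _ _)
  rw [heq]
  exact this

theorem linearIndependent_mul_of_algebraMap {K L ι κ : Type*} [Field K] [Field L] [Algebra K A]
    [Algebra K F] [Algebra K L] [Algebra L F] [IsScalarTower K A F] [IsScalarTower K L F]
    {b : ι → A} (hb : LinearIndependent K b) {b' : ι → L}
    (hbb' : ∀ i, algebraMap L F (b' i) = algebraMap A F (b i)) {a : κ → A}
    (ha : LinearIndependent L fun x => algebraMap A F (a x)) :
    LinearIndependent K fun q : ι × κ => b q.1 * a q.2 := by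
  have hb' : LinearIndependent K b' := by
    refine LinearIndependent.of_comp (IsScalarTower.toAlgHom K L F).toLinearMap ?_
    have heq : (IsScalarTower.toAlgHom K L F).toLinearMap ∘ b' =
      (IsScalarTower.toAlgHom K A F).toLinearMap ∘ b := funext hbb'
    rw [heq]
    exact hb.map' _ (LinearMap.ker_eq_bot.2 (IsFractionRing.injective A F))
  refine LinearIndependent.of_comp (IsScalarTower.toAlgHom K A F).toLinearMap ?_
  have heq : (IsScalarTower.toAlgHom K A F).toLinearMap ∘ (fun q : ι × κ => b q.1 * a q.2) =
      fun q : ι × κ => b' q.1 • algebraMap A F (a q.2) := by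
    funext q
    rw [Algebra.smul_def, hbb', ← map_mul]
    rfl
  rw [heq]
  have h := linearIndependent_smul (R := K) (S := L) (A := F) hb' ha
  exact h

end ClearDenominators

/-- After clearing denominators, multiply the family by the products of powers of `f` with exponents
at most `E`. This gives `(E+1)^n * s.card` independent polynomials in a space of dimension
`(n*d*E+E+1)^n ≤ ((n*d+1)*(E+1))^n`. -/
theorem card_le_of_linearIndependent_generatedField {K : Type*} [Field K] {n : ℕ}
    {f : Fin n → MvPolynomial (Fin n) K} (hf : AlgebraicIndependent K f) {d : ℕ}
    (hd : ∀ i j, degreeOf j (f i) ≤ d) (s : Finset (FractionRing (MvPolynomial (Fin n) K)))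
    (hs : LinearIndependent (generatedField f)
      fun i : s => (i : FractionRing (MvPolynomial (Fin n) K))) :
    s.card ≤ (n * d + 1) ^ n := by
  classical
  have hmem : ∀ e : Fin n → ℕ, algebraMap (MvPolynomial (Fin n) K)
      (FractionRing (MvPolynomial (Fin n) K)) (∏ i, f i ^ e i) ∈ generatedField f := by
    intro e
    rw [map_prod]
    refine prod_mem fun i _ => ?_
    rw [map_pow]
    exact pow_mem (IntermediateField.subset_adjoin K
      (Set.range fun i => algebraMap _ (FractionRing (MvPolynomial (Fin n) K)) (f i)) ⟨i, rfl⟩) _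
  obtain ⟨a, ha⟩ := exists_linearIndependent_algebraMap (A := MvPolynomial (Fin n) K) s hs
  obtain ⟨E, hE⟩ : ∃ E, ∀ i j, degreeOf j (a i) ≤ E :=
    ⟨Finset.univ.sup fun q : s × Fin n => degreeOf q.2 (a q.1), fun i j =>
      Finset.le_sup (f := fun q : s × Fin n => degreeOf q.2 (a q.1)) (Finset.mem_univ (i, j))⟩
  have hpoly := linearIndependent_mul_of_algebraMap
    (hf.linearIndependent_prod_pow (N := E)) (b' := fun e => ⟨_, hmem fun i => e i⟩)
    (fun _ => rfl) ha
  have hcard := card_le_of_linearIndependent_of_degreeOf_le hpoly (M := n * d * E + E)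
    fun q j => (degreeOf_mul_le _ _ _).trans
      (add_le_add (degreeOf_prod_pow_le hd _ _) (hE _ _))
  simp only [Fintype.card_prod, Fintype.card_fun, Fintype.card_fin, Fintype.card_coe] at hcard
  refine Nat.le_of_mul_le_mul_left (hcard.trans ?_) (pow_pos E.succ_pos n)
  rw [← mul_pow]
  refine Nat.pow_le_pow_left ?_ n
  nlinarith [Nat.zero_le (n * d)]

theorem extensionDegree_pos_and_le {K : Type*} [Field K] {n : ℕ}
    {f : Fin n → MvPolynomial (Fin n) K} (hf : AlgebraicIndependent K f) {d : ℕ}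
    (hd : ∀ i j, degreeOf j (f i) ≤ d) :
    0 < extensionDegree f ∧ extensionDegree f ≤ (n * d + 1) ^ n := by
  have hrank := rank_le (R := generatedField f) (M := FractionRing (MvPolynomial (Fin n) K))
    (card_le_of_linearIndependent_generatedField hf hd)
  have hfin : Module.Finite (generatedField f) (FractionRing (MvPolynomial (Fin n) K)) :=
    Module.rank_lt_aleph0_iff.1 (hrank.trans_lt (Cardinal.natCast_lt_aleph0))
  refine ⟨Module.finrank_pos, ?_⟩
  rw [← Module.finrank_eq_rank] at hrank
  exact_mod_cast hrank

/-! ### Bounding the degree of the inverse -/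

/-- A dimension count gives a nonzero `P` of degree at most `N` in each variable with `X i ∣ P(f)`.
Pulling the factorization back along `f` gives `G ∣ P`, so `G` inherits the bound. -/
theorem exists_aeval_eq_X_of_isAutomorphicTuple {K : Type*} [Field K] {n : ℕ}
    {f : Fin n → MvPolynomial (Fin n) K} (hf : AlgebraicIndependent K f)
    (hauto : IsAutomorphicTuple f) {d : ℕ} (hd : ∀ i j, degreeOf j (f i) ≤ d) (i : Fin n) :
    ∃ G : MvPolynomial (Fin n) K, aeval f G = X i ∧ ∀ j, degreeOf j G ≤ (n * d + 1) ^ n := by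
  classical
  set N := (n * d + 1) ^ n
  have hsurj : Function.Surjective (aeval (R := K) f) := by
    rw [← AlgHom.range_eq_top (aeval (R := K) f), ← Algebra.adjoin_range_eq_range_aeval K f]
    exact hauto
  obtain ⟨G, hG⟩ := hsurj (X i)
  refine ⟨G, hG, fun j => ?_⟩
  -- `μ` lists the monomials free of `X i` that can occur in `P(f)`; `Ψ` reads their coefficients.
  let μ : ({j : Fin n // j ≠ i} → Fin (n * d * N + 1)) → (Fin n →₀ ℕ) := fun e' =>
    Finsupp.equivFunOnFinite.symm fun j => if h : j ≠ i then (e' ⟨j, h⟩ : ℕ) else 0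
  let Θ : ((Fin n → Fin (N + 1)) → K) →ₗ[K] MvPolynomial (Fin n) K :=
    Fintype.linearCombination K fun e : Fin n → Fin (N + 1) =>
      monomial (Finsupp.equivFunOnFinite.symm fun i => (e i : ℕ)) 1
  let Ψ : ((Fin n → Fin (N + 1)) → K) →ₗ[K]
      (({j : Fin n // j ≠ i} → Fin (n * d * N + 1)) → K) :=
    (LinearMap.pi fun e' => lcoeff K (μ e')) ∘ₗ (aeval f).toLinearMap ∘ₗ Θ
  have hker : LinearMap.ker Ψ ≠ ⊥ := by
    refine LinearMap.ker_ne_bot_of_finrank_lt ?_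
    have hn : n = (n - 1) + 1 := (Nat.succ_pred_eq_of_pos i.pos).symm
    have hcard : Fintype.card {j : Fin n // j ≠ i} = n - 1 := by simp
    simp only [Module.finrank_fintype_fun_eq_card, Fintype.card_fun, hcard, Fintype.card_fin]
    have h1 : (n * d * N + 1) ≤ (n * d + 1) * (N + 1) := by nlinarith [Nat.zero_le (n * d)]
    have h2 : (n * d + 1) ^ (n - 1) < N + 1 :=
      Nat.lt_succ_of_le (Nat.pow_le_pow_right (Nat.succ_pos _) (Nat.sub_le n 1))
    calc (n * d * N + 1) ^ (n - 1) ≤ ((n * d + 1) * (N + 1)) ^ (n - 1) := Nat.pow_le_pow_left h1 _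
      _ = (n * d + 1) ^ (n - 1) * (N + 1) ^ (n - 1) := mul_pow _ _ _
      _ < (N + 1) * (N + 1) ^ (n - 1) := Nat.mul_lt_mul_of_pos_right h2 (by positivity)
      _ = (N + 1) ^ n := by conv_rhs => rw [hn, pow_succ']
  obtain ⟨c, hc, hc0⟩ := Submodule.exists_mem_ne_zero_of_ne_bot hker
  have hΘ : Θ c = ∑ e, c e • monomial (Finsupp.equivFunOnFinite.symm fun i => (e i : ℕ)) 1 :=
    Fintype.linearCombination_apply ..
  have hΘ0 : Θ c ≠ 0 := fun h0 => hc0 <| funext <|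
    Fintype.linearIndependent_iff.1 linearIndependent_monomial_fin_box c (hΘ ▸ h0)
  have hfP : aeval f (Θ c) = ∑ e, c e • ∏ i, f i ^ (e i : ℕ) := by
    rw [hΘ, map_sum]
    refine Finset.sum_congr rfl fun e _ => ?_
    rw [map_smul, aeval_monomial_equivFunOnFinite_symm]
  have hΘd : ∀ j, degreeOf j (Θ c) ≤ N := by
    intro j
    rw [hΘ]
    refine (degreeOf_sum_le _ _ _).trans (Finset.sup_le fun e _ => ?_)
    rw [smul_monomial]
    refine (degreeOf_le_iff.2 fun m hm => ?_)
    have := Finset.mem_singleton.1 (support_monomial_subset hm)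
    rw [this]
    exact Nat.lt_succ_iff.1 (e j).2
  have hfPd : ∀ j, degreeOf j (aeval f (Θ c)) ≤ n * d * N := by
    intro j
    rw [hfP]
    refine (degreeOf_sum_le _ _ _).trans (Finset.sup_le fun e _ => ?_)
    rw [smul_eq_C_mul]
    exact (degreeOf_C_mul_le _ _ _).trans (degreeOf_prod_pow_le hd e j)
  have hdvd : X i ∣ aeval f (Θ c) := by
    rw [X_dvd_iff_modMonomial_eq_zero]
    ext m
    by_cases hm : Finsupp.single i 1 ≤ m
    · rw [coeff_modMonomial_of_le _ hm, coeff_zero]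
    rw [coeff_modMonomial_of_not_le _ hm, coeff_zero]
    by_contra hne
    have hle := fun j => degreeOf_le_iff.1 (hfPd j) m (mem_support_iff.2 hne)
    have hμ : μ (fun j => ⟨m j, Nat.lt_succ_of_le (hle j)⟩) = m := by
      ext j
      by_cases hj : j = i
      · subst hj
        simp at hm
        simp [μ, hm]
      · simp [μ, hj]
    have := congrFun (LinearMap.mem_ker.1 hc) fun j => ⟨m j, Nat.lt_succ_of_le (hle j)⟩
    refine hne ?_
    rw [← hμ]
    exact this
  obtain ⟨q, hq⟩ := hdvd
  obtain ⟨Q, rfl⟩ := hsurj q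
  have hmul : Θ c = G * Q := hf (by rw [hq, map_mul, hG])
  rw [hmul] at hΘ0
  have := hΘd j
  rw [hmul, degreeOf_mul_eq (left_ne_zero_of_mul hΘ0) (right_ne_zero_of_mul hΘ0)] at this
  exact (Nat.le_add_right _ _).trans this

theorem X_mem_span_prod_pow {K : Type*} [Field K] {n : ℕ}
    {f : Fin n → MvPolynomial (Fin n) K} (hf : AlgebraicIndependent K f)
    (hauto : IsAutomorphicTuple f) {d : ℕ} (hd : ∀ i j, degreeOf j (f i) ≤ d) (i : Fin n) :
    X i ∈ Submodule.span K (Set.range fun e : Fin n → Fin ((n * d + 1) ^ n + 1) =>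
      ∏ i, f i ^ (e i : ℕ)) := by
  obtain ⟨G, hG, hGd⟩ := exists_aeval_eq_X_of_isAutomorphicTuple hf hauto hd i
  rw [← hG, G.as_sum, map_sum]
  refine Submodule.sum_mem _ fun m hm => ?_
  have hm' := fun j => degreeOf_le_iff.1 (hGd j) m hm
  have hmon : monomial m (coeff m G) = coeff m G • monomial m (1 : K) := by
    rw [smul_monomial, smul_eq_mul, mul_one]
  rw [hmon, map_smul]
  refine Submodule.smul_mem _ _ (Submodule.subset_span
    ⟨fun j => ⟨m j, Nat.lt_succ_of_le (hm' j)⟩, ?_⟩)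
  exact (aeval_monomial_equivFunOnFinite_symm f m).symm.trans (by simp)

/-! ### Transfer of the functional and conclusion -/

theorem map_sum_mul_coeff {A B σ : Type*} [CommSemiring A] [CommSemiring B] (ψ : A →+* B)
    (T : Finset (σ →₀ ℕ)) (v : (σ →₀ ℕ) → A) (P : MvPolynomial σ A) :
    ψ (∑ m ∈ T, v m * coeff m P) = ∑ m ∈ T, ψ (v m) * coeff m (map ψ P) := by
  simp [coeff_map]

theorem linearMap_eq_sum_mul_coeff {k σ : Type*} [CommSemiring k] (l : MvPolynomial σ k →ₗ[k] k)
    {T : Finset (σ →₀ ℕ)} {P : MvPolynomial σ k} (hP : P.support ⊆ T) :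
    l P = ∑ m ∈ T, l (monomial m 1) * coeff m P := by
  conv_lhs => rw [P.as_sum]
  rw [map_sum, Finset.sum_subset hP fun m _ hm => by simp [notMem_support_iff.1 hm]]
  refine Finset.sum_congr rfl fun m _ => ?_
  have hmon : monomial m (coeff m P) = coeff m P • monomial m (1 : k) := by
    rw [smul_monomial, smul_eq_mul, mul_one]
  rw [hmon, map_smul, smul_eq_mul, mul_comm]

theorem jacobianDet_map_eq {R K : Type*} [CommRing R] [Field K] {n : ℕ} (φ : R →+* K)
    (F : Fin n → MvPolynomial (Fin n) R) : jacobianDet (fun i => map φ (F i)) =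
      map φ (Matrix.det (Matrix.of fun i j => pderiv j (F i))) := by
  rw [jacobianDet, RingHom.map_det]
  congr 1
  ext1 i j
  simp [pderiv_map]

theorem jacobianDet_map_eq_C {R k K : Type*} [CommRing R] [Field k] [Field K] {n : ℕ}
    {ι : R →+* k} (hι : Function.Injective ι) (φ : R →+* K) (F : Fin n → MvPolynomial (Fin n) R)
    {c : R} (h : jacobianDet (fun i => map ι (F i)) = C (ι c)) :
    jacobianDet (fun i => map φ (F i)) = C (φ c) := by
  rw [jacobianDet_map_eq, ← map_C] at h
  rw [jacobianDet_map_eq, map_injective ι hι h, map_C]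

theorem proposition1p6
    (hSep : ∀ p : ℕ, p.Prime → SeparableJacobianConjectureTwo.{0} p) :
    JacobianConjectureTwo.{u} := by
  classical
  rintro k _ _ f ⟨c, hc0, hc⟩
  by_contra hnot
  obtain ⟨i, hi⟩ : ∃ i, (X i : MvPolynomial (Fin 2) k) ∉ Algebra.adjoin k (Set.range f) := by
    by_contra! hall
    refine hnot (top_unique ?_)
    rw [← adjoin_range_X, Algebra.adjoin_le_iff]
    rintro _ ⟨i, rfl⟩
    exact hall i
  obtain ⟨l, hl0, hl⟩ := Submodule.exists_le_ker_of_notMem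
    (p := Subalgebra.toSubmodule (Algebra.adjoin k (Set.range f))) hi
  obtain ⟨d, hd⟩ : ∃ d, ∀ i j, degreeOf j (f i) ≤ d :=
    ⟨Finset.univ.sup fun q : Fin 2 × Fin 2 => degreeOf q.2 (f q.1), fun i j =>
      Finset.le_sup (f := fun q : Fin 2 × Fin 2 => degreeOf q.2 (f q.1)) (Finset.mem_univ (i, j))⟩
  set N := (2 * d + 1) ^ 2
  -- `T` contains every monomial on which `l` will be evaluated.
  let T : Finset (Fin 2 →₀ ℕ) := {Finsupp.single i 1} ∪
    Finset.univ.biUnion fun e : Fin 2 → Fin (N + 1) => (∏ j, f j ^ (e j : ℕ)).support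
  let s : Finset k := {c} ∪ (T.image fun m => l (monomial m 1)) ∪
    Finset.univ.biUnion fun j => (f j).support.image fun m => coeff m (f j)
  obtain ⟨R, p, hp, φ, hNp, hsR, hφ⟩ := exists_subring_ringHom_algebraicClosure_zmod s N
  have hinj : Function.Injective R.subtype := Subtype.val_injective
  have hF : ∀ j, ∃ F : MvPolynomial (Fin 2) R, map R.subtype F = f j := by
    intro j
    refine mem_range_map_iff_coeffs_subset.2 fun x hx => ?_
    obtain ⟨m, hm, rfl⟩ := mem_coeffs_iff.1 hx
    refine ⟨⟨_, hsR ?_⟩, rfl⟩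
    simp only [s, Finset.coe_union, Set.mem_union, Finset.mem_coe, Finset.mem_biUnion,
      Finset.mem_image]
    exact Or.inr ⟨j, Finset.mem_univ j, m, hm, rfl⟩
  choose F hF using hF
  have hcs : c ∈ s := by simp [s]
  have hls : ∀ m ∈ T, l (monomial m 1) ∈ s := fun m hm =>
    Finset.mem_union_left _ (Finset.mem_union_right _ (Finset.mem_image_of_mem _ hm))
  set g : Fin 2 → MvPolynomial (Fin 2) (AlgebraicClosure (ZMod p)) := fun j => map φ (F j)
  have : CharP (AlgebraicClosure (ZMod p)) p := inferInstance
  have hgjac : jacobianDet g = C (φ ⟨c, hsR hcs⟩) := by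
    refine jacobianDet_map_eq_C hinj φ F ?_
    simp only [hF]
    exact hc
  have hφc : φ ⟨c, hsR hcs⟩ ≠ 0 := hφ _ hcs hc0
  have hgind : AlgebraicIndependent (AlgebraicClosure (ZMod p)) g :=
    algebraicIndependent_of_jacobianDet_ne_zero p (by rw [hgjac]; simpa using hφc)
  have hgd : ∀ i j, degreeOf j (g i) ≤ d := by
    intro i j
    refine degreeOf_le_iff.2 fun m hm => degreeOf_le_iff.1 (hd i j) m ?_
    rw [← hF i, support_map_of_injective _ hinj]
    exact support_map_subset _ _ hm
  obtain ⟨hpos, hle⟩ := extensionDegree_pos_and_le hgind hgd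
  -- The closure of `ZMod p` lives in `Type`, so universe `0` suffices for the hypothesis.
  have hgauto : IsAutomorphicTuple g := (hSep p hp.out _ g).2
    ⟨⟨_, hφc, hgjac⟩, Nat.not_dvd_of_pos_of_lt hpos (hle.trans_lt hNp)⟩
  have hspan := X_mem_span_prod_pow hgind hgauto hgd i
  -- The default `0` is harmless: all sums run over `T`.
  let v : (Fin 2 →₀ ℕ) → R := fun m =>
    if hm : m ∈ T then ⟨l (monomial m 1), hsR (hls m hm)⟩ else 0
  let Λ : MvPolynomial (Fin 2) (AlgebraicClosure (ZMod p)) →ₗ[AlgebraicClosure (ZMod p)]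
      AlgebraicClosure (ZMod p) := ∑ m ∈ T, φ (v m) • lcoeff _ m
  have hΛ : ∀ P, Λ P = ∑ m ∈ T, φ (v m) * coeff m P := fun P => by simp [Λ, lcoeff]
  have hred : ∀ P : MvPolynomial (Fin 2) R, (map R.subtype P).support ⊆ T →
      ∃ r : R, (r : k) = l (map R.subtype P) ∧ Λ (map φ P) = φ r := by
    intro P hP
    refine ⟨∑ m ∈ T, v m * coeff m P, ?_, ?_⟩
    · rw [linearMap_eq_sum_mul_coeff l hP]
      refine (map_sum_mul_coeff R.subtype T v P).trans (Finset.sum_congr rfl fun m hm => ?_)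
      simp [v, hm]
    · rw [hΛ, map_sum_mul_coeff]
  have hker : Submodule.span (AlgebraicClosure (ZMod p))
      (Set.range fun e : Fin 2 → Fin (N + 1) => ∏ j, g j ^ (e j : ℕ)) ≤ LinearMap.ker Λ := by
    rw [Submodule.span_le]
    rintro _ ⟨e, rfl⟩
    have hmap : map R.subtype (∏ j, F j ^ (e j : ℕ)) = ∏ j, f j ^ (e j : ℕ) := by
      simp only [map_prod, map_pow, hF]
    obtain ⟨r, hr, hr'⟩ := hred (∏ j, F j ^ (e j : ℕ)) <| by
      rw [hmap]
      exact (Finset.subset_biUnion_of_mem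
        (fun e : Fin 2 → Fin (N + 1) => (∏ j, f j ^ (e j : ℕ)).support)
        (Finset.mem_univ e)).trans Finset.subset_union_right
    have h0 : l (∏ j, f j ^ (e j : ℕ)) = 0 := hl <| Subalgebra.prod_mem _ fun j _ =>
      Subalgebra.pow_mem _ (Algebra.subset_adjoin (Set.mem_range_self j)) _
    rw [hmap, h0] at hr
    have hr0 : r = 0 := Subtype.ext hr
    rw [hr0, map_zero, map_prod] at hr'
    simpa [g] using hr'
  have hXs : (map R.subtype (X i)).support ⊆ T := by
    rw [map_X, support_X]
    exact Finset.subset_union_left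
  obtain ⟨r, hr, hr'⟩ := hred (X i) hXs
  rw [map_X] at hr hr'
  rw [LinearMap.mem_ker.1 (hker hspan)] at hr'
  -- `r` is the nonzero scalar `l (X i)`, an element of `s`, yet `φ r = 0`.
  refine hφ r ?_ ?_ hr'.symm
  · rw [hr]
    exact hls (Finsupp.single i 1) (by simp [T])
  · rwa [hr]
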